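/- Let $\mathcal N_n=\{K\in\mathbb R^{n\times n}: K^T=-K\}$ be the manifold (real vector space) of real $n\times n$ skew-symmetric matrices. Eigenvalues are taken in $\mathbb C$; $K$ is called derogatory if some eigenvalue has geometric multiplicity at least $2$. A set $S\subseteq\mathcal N_n$ is said to have codimension $c$ if it is a countable union of smooth embedded submanifolds of $\mathcal N_n$, each of codimension at least $c$, at least one of them being nonempty and of codimension exactly $c$ (where a submanifold $\mathcal M$ has codimension $\dim\mathcal N_n-\dim\mathcal M$). (1) The set of derogatory matrices in $\mathcal N_n$ has codimension $1$ if $n\ge 2$ is even, and codimension $3$ if $n\ge 3$ is odd. (2) For $n\ge 4$, the set of matrices in $\mathcal N_n$ having a nonzero eigenvalue of (algebraic) multiplicity at least $2$ has codimension $3$. For $n\le 3$ this set is empty. (3) Let $n\ge2$ be even. The matrices in $\mathcal N_n$ for which $0$ is an eigenvalue of (algebraic) multiplicity at least $2$ are exactly those with $\det K=0$; they form a set of codimension $1$, and the derogatory matrices are exactly those with $\det K=0$ or with a nonzero eigenvalue of multiplicity at least $2$. (Thus, by (2), the codimension $1$ in (1) comes entirely from the double eigenvalue at $0$.) -/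

import Mathlib

open scoped ContDiff

noncomputable section

/-- The real vector space of real `n × n` skew-symmetric matrices, `Kᵀ = -K`. -/
def skewSymm (n : ℕ) : Submodule ℝ (Matrix (Fin n) (Fin n) ℝ) where
  carrier := {K | K.transpose = -K}
  add_mem' := by
    intro A B hA hB
    simp only [Set.mem_ofPred_eq] at hA hB ⊢
    rw [Matrix.transpose_add, hA, hB, neg_add]
  zero_mem' := by simp
  smul_mem' := by
    intro c A hA
    simp only [Set.mem_ofPred_eq] at hA ⊢
    rw [Matrix.transpose_smul, hA, smul_neg]

/-- The space of skew-symmetric matrices with the entrywise maximum norm. It is finite dimensional,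
so its topology and its smooth structure do not depend on the choice of the norm. -/
instance skewSymm.normedAddCommGroup (n : ℕ) : NormedAddCommGroup (skewSymm n) :=
  @Submodule.normedAddCommGroup ℝ (Matrix (Fin n) (Fin n) ℝ) _ Matrix.normedAddCommGroup _
    (skewSymm n)

instance skewSymm.normedSpace (n : ℕ) : NormedSpace ℝ (skewSymm n) :=
  @Submodule.normedSpace ℝ ℝ _ _ _ (Matrix (Fin n) (Fin n) ℝ) Matrix.seminormedAddCommGroup
    Matrix.normedSpace _ _ (skewSymm n)

/-- `M` is a smooth embedded submanifold of codimension `c` of the finite-dimensional space `E`: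
around each of its points, `M` is the zero set of a smooth submersion to `ℝ^c`. Thus
`dim E - dim M = c`. The empty set counts as a submanifold of every codimension. -/
def IsSubmanifoldOfCodim {E : Type*} [NormedAddCommGroup E] [NormedSpace ℝ E]
    (M : Set E) (c : ℕ) : Prop :=
  ∀ x ∈ M, ∃ U : Set E, IsOpen U ∧ x ∈ U ∧ ∃ f : E → (Fin c → ℝ),
    ContDiffOn ℝ ∞ f U ∧ (∀ y ∈ U, Function.Surjective (fderiv ℝ f y)) ∧
      M ∩ U = {y | y ∈ U ∧ f y = 0}

/-- The set `S`, which may be singular, has codimension `c` in `E`: it is a countable union of smooth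
embedded submanifolds of `E`, all of codimension at least `c`, and one of them is nonempty of
codimension exactly `c`. (Finite unions are included, since members may be empty.) -/
def HasCodim {E : Type*} [NormedAddCommGroup E] [NormedSpace ℝ E] (S : Set E) (c : ℕ) : Prop :=
  ∃ (M : ℕ → Set E) (k : ℕ → ℕ),
    (∀ i, IsSubmanifoldOfCodim (M i) (k i) ∧ c ≤ k i) ∧
      S = ⋃ i, M i ∧ ∃ i, k i = c ∧ (M i).Nonempty

/-- A real matrix, regarded as a complex one. -/
def complexify {n : ℕ} (K : Matrix (Fin n) (Fin n) ℝ) : Matrix (Fin n) (Fin n) ℂ :=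
  K.map (fun x : ℝ => (x : ℂ))

/-- A real matrix is derogatory if some complex eigenvalue has geometric multiplicity at least 2. -/
def IsDerogatory {n : ℕ} (K : Matrix (Fin n) (Fin n) ℝ) : Prop :=
  ∃ z : ℂ, 2 ≤ Module.finrank ℂ
    (Module.End.eigenspace (Matrix.toLin' (complexify K)) z)

/-- `z` is an eigenvalue of the real matrix `K` of algebraic multiplicity at least 2. -/
def IsRepeatedEigenvalue {n : ℕ} (K : Matrix (Fin n) (Fin n) ℝ) (z : ℂ) : Prop :=
  2 ≤ (complexify K).charpoly.rootMultiplicity z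

/-- The derogatory real skew-symmetric matrices. -/
def derogatorySkew (n : ℕ) : Set (skewSymm n) :=
  {K | IsDerogatory (K : Matrix (Fin n) (Fin n) ℝ)}

/-- The real skew-symmetric matrices with a repeated nonzero eigenvalue. -/
def repeatedNonzeroSkew (n : ℕ) : Set (skewSymm n) :=
  {K | ∃ z : ℂ, z ≠ 0 ∧ IsRepeatedEigenvalue (K : Matrix (Fin n) (Fin n) ℝ) z}

/-- The real skew-symmetric matrices for which `0` is a repeated eigenvalue. -/
def repeatedZeroSkew (n : ℕ) : Set (skewSymm n) :=
  {K | IsRepeatedEigenvalue (K : Matrix (Fin n) (Fin n) ℝ) 0}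

end

/-! For real `μ` the matrix `K - μ i` is skew-Hermitian, so the eigenvalues of `K` are imaginary and
their geometric and algebraic multiplicities agree. Everything reduces to the loci where `K - μ i`
has nullity exactly `m`.

Near such a point, border the matrix by an orthonormal kernel basis `V` and by `-Vᴴ`. The corner of
the inverse is an `m × m` skew-Hermitian matrix, vanishing exactly where the nullity is `m`, with
derivative `h ↦ Vᴴ h V` (`IsKernelFrame.contDiffAt_borderedCorner`).

For `μ = 0` the corner is real, which gives `m.choose 2` independent equations. The nullity has the
parity of `n`, so the first relevant `m` is 2 or 3, of codimension 1 or 3.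

For `μ ≠ 0` the columns of `V` are orthogonal to their conjugates, so real perturbations of `K`
already reach every skew-Hermitian value (`exists_skewSymm_compression`). This gives `m²` equations
on `(K, μ)`, and forgetting `μ` leaves codimension `m² - 1 ≥ 3`
(`exists_isSubmanifoldOfCodim_image_fst`). Sums of rotation generators and a zero block show that
the needed strata are nonempty. -/

open Topology Filter
open scoped Matrix ComplexOrder ContDiff

/-! ### Submanifolds, their projections and countable unions. -/

section Submanifold

variable {E : Type*} [NormedAddCommGroup E] [NormedSpace ℝ E]

/-- Surjectivity of a continuous linear map onto a finite-dimensional space is an open condition. -/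
theorem ContinuousLinearMap.eventually_surjective {G : Type*} [NormedAddCommGroup G]
    [NormedSpace ℝ G] [FiniteDimensional ℝ G] {L : E →L[ℝ] G} (hL : Function.Surjective L) :
    ∀ᶠ L' : E →L[ℝ] G in 𝓝 L, Function.Surjective L' := by
  have : CompleteSpace G := FiniteDimensional.complete ℝ G
  obtain ⟨R, hR⟩ := (L : E →ₗ[ℝ] G).exists_rightInverse_of_surjective
    (LinearMap.range_eq_top.2 hL)
  let R' : G →L[ℝ] E := LinearMap.toContinuousLinearMap R
  have hcont : Continuous fun L' : E →L[ℝ] G => L'.comp R' := by fun_prop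
  have hone : L.comp R' = 1 := by
    ext y
    exact LinearMap.congr_fun hR y
  have hmem : {T : G →L[ℝ] G | IsUnit T} ∈ 𝓝 (L.comp R') := by
    rw [hone]
    exact Units.isOpen.mem_nhds isUnit_one
  filter_upwards [hcont.continuousAt.preimage_mem_nhds hmem] with L' hL' y
  obtain ⟨u, hu⟩ : IsUnit (L'.comp R') := hL'
  refine ⟨R' ((↑u⁻¹ : G →L[ℝ] G) y), ?_⟩
  have h : (L'.comp R') * (↑u⁻¹ : G →L[ℝ] G) = 1 := by rw [← hu]; simp
  exact congrArg (fun T : G →L[ℝ] G => T y) h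

/-- Near a point where an analytic map is a submersion, it is a smooth submersion. -/
theorem ContDiffAt.eventually_submersion {c : ℕ} {f : E → Fin c → ℝ} {x : E}
    (hf : ContDiffAt ℝ ω f x) (hs : Function.Surjective (fderiv ℝ f x)) :
    ∀ᶠ y in 𝓝 x, ContDiffAt ℝ ∞ f y ∧ Function.Surjective (fderiv ℝ f y) := by
  -- Analyticity spreads to a neighbourhood; being `C^∞` at a point, in Mathlib's sense, need not.
  have h1 : ∀ᶠ y in 𝓝 x, ContDiffAt ℝ ω f y := hf.eventually (by simp)
  have hc : ContinuousAt (fderiv ℝ f) x :=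
    (hf.fderiv_right (m := 0) (by simp)).continuousAt
  filter_upwards [h1, hc.eventually (ContinuousLinearMap.eventually_surjective hs)] with y hy hy'
  exact ⟨hy.of_le le_top, hy'⟩

theorem isSubmanifoldOfCodim_of_eventually {M : Set E} {c : ℕ}
    (h : ∀ x ∈ M, ∃ f : E → Fin c → ℝ, ContDiffAt ℝ ω f x ∧
      Function.Surjective (fderiv ℝ f x) ∧ ∀ᶠ y in 𝓝 x, y ∈ M ↔ f y = 0) :
    IsSubmanifoldOfCodim M c := by
  intro x hx
  obtain ⟨f, hf, hs, hM⟩ := h x hx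
  obtain ⟨U, hU, hUo, hxU⟩ := eventually_nhds_iff.1 ((hf.eventually_submersion hs).and hM)
  refine ⟨U, hUo, hxU, f, fun y hy => (hU y hy).1.1.contDiffWithinAt,
    fun y hy => (hU y hy).1.2, ?_⟩
  ext y
  constructor
  · rintro ⟨hyM, hyU⟩
    exact ⟨hyU, (hU y hyU).2.1 hyM⟩
  · rintro ⟨hyU, hy⟩
    exact ⟨(hU y hyU).2.2 hy, hyU⟩

/-- If `T ⊆ E × ℝ` is locally the zero set of a map `F` that is a submersion in the first variable
and immersive in the second, then locally the projection of `T` to `E` is a submanifold. -/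
theorem exists_isSubmanifoldOfCodim_image_fst [CompleteSpace E] {d : ℕ} {T : Set (E × ℝ)}
    {F : E × ℝ → Fin (d + 1) → ℝ} {u : E × ℝ} (huT : u ∈ T) (hF : ContDiffAt ℝ ω F u)
    (hT : ∀ᶠ v in 𝓝 u, v ∈ T ↔ F v = 0)
    (hs : Function.Surjective fun x : E => fderiv ℝ F u (x, 0))
    (ht : fderiv ℝ F u (0, 1) ≠ 0) :
    ∃ W ∈ 𝓝 u, IsSubmanifoldOfCodim (Prod.fst '' (T ∩ W)) d := by
  set v₀ := fderiv ℝ F u (0, 1) with hv₀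
  -- The scalar equation `l ∘ F = 0` has derivative 1 in the real variable, so it can be solved for
  -- that variable; `Q` keeps the other `d` equations.
  obtain ⟨l, hl⟩ := SeparatingDual.exists_eq_one (R := ℝ) ht
  -- a linear map with kernel spanned by `v₀`
  obtain ⟨Q, hQs, hQ⟩ : ∃ Q : (Fin (d + 1) → ℝ) →L[ℝ] (Fin d → ℝ),
      Function.Surjective Q ∧ ∀ y, Q y = 0 ↔ ∃ a : ℝ, a • v₀ = y := by
    have hfin : Module.finrank ℝ ((Fin (d + 1) → ℝ) ⧸ (ℝ ∙ v₀)) = Module.finrank ℝ (Fin d → ℝ) := by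
      have := Submodule.finrank_quotient_add_finrank (ℝ ∙ v₀)
      rw [finrank_span_singleton ht] at this
      simp at this ⊢
      omega
    let e := LinearEquiv.ofFinrankEq _ _ hfin
    refine ⟨LinearMap.toContinuousLinearMap (e.toLinearMap ∘ₗ (ℝ ∙ v₀).mkQ), ?_, fun y => ?_⟩
    · exact e.surjective.comp (Submodule.mkQ_surjective _)
    · simp [Submodule.mem_span_singleton]
  have hFu : F u = 0 := hT.self_of_nhds.1 huT
  have hlF : ContDiffAt ℝ ω (fun v => l (F v)) u := l.contDiff.contDiffAt.comp u hF
  have hFd : HasFDerivAt F (fderiv ℝ F u) u := (hF.differentiableAt (by simp)).hasFDerivAt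
  have hlFd : fderiv ℝ (fun v => l (F v)) u = l.comp (fderiv ℝ F u) :=
    (l.hasFDerivAt.comp u hFd).fderiv
  have hinv : (fderiv ℝ (fun v => l (F v)) u ∘L .inr ℝ E ℝ).IsInvertible := by
    have : (fderiv ℝ (fun v => l (F v)) u ∘L .inr ℝ E ℝ) = ContinuousLinearMap.id ℝ ℝ := by
      ext
      rw [hlFd]
      simpa using hl
    rw [this]
    exact ⟨ContinuousLinearEquiv.refl ℝ ℝ, rfl⟩
  set τ := hlF.implicitFunction (by simp) hinv with hτ
  have hτu : τ u.1 = u.2 := hlF.implicitFunction_apply_self _ hinv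
  have hτc : ContDiffAt ℝ ω τ u.1 := hlF.contDiffAt_implicitFunction _ hinv
  have hτiff : ∀ᶠ v in 𝓝 u, l (F v) = 0 ↔ τ v.1 = v.2 := by
    have := hlF.eventually_apply_eq_iff_implicitFunction (by simp) hinv
    simpa [hFu] using this
  have hgc : ContDiffAt ℝ ω (fun x => (x, τ x)) u.1 := contDiffAt_id.prodMk hτc
  have hgu : (u.1, τ u.1) = u := by rw [hτu]
  set f : E → Fin d → ℝ := fun x => Q (F (x, τ x)) with hf
  have hfc : ContDiffAt ℝ ω f u.1 := by
    refine Q.contDiff.contDiffAt.comp _ (ContDiffAt.comp u.1 ?_ hgc)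
    rwa [hgu]
  have hfs : Function.Surjective (fderiv ℝ f u.1) := by
    have hτd : HasFDerivAt τ (fderiv ℝ τ u.1) u.1 := (hτc.differentiableAt (by simp)).hasFDerivAt
    have hgd := (hasFDerivAt_id u.1).prodMk hτd
    have hFd' : HasFDerivAt F (fderiv ℝ F u) (id u.1, τ u.1) := by
      have : (id u.1, τ u.1) = u := hgu
      rwa [this]
    have hfd : HasFDerivAt f (Q.comp ((fderiv ℝ F u).comp
        ((ContinuousLinearMap.id ℝ E).prod (fderiv ℝ τ u.1)))) u.1 :=
      Q.hasFDerivAt.comp u.1 (hFd'.comp u.1 hgd)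
    rw [hfd.fderiv]
    intro y
    obtain ⟨z, rfl⟩ := hQs y
    obtain ⟨x, rfl⟩ := hs z
    refine ⟨x, ?_⟩
    -- The derivative of `τ` only contributes a multiple of `v₀`, which `Q` kills, so it need not be
    -- computed.
    have hsplit : (x, fderiv ℝ τ u.1 x) = (x, (0 : ℝ)) + (fderiv ℝ τ u.1 x) • ((0 : E), (1 : ℝ)) := by
      simp
    have hQv : Q v₀ = 0 := (hQ _).2 ⟨1, one_smul _ _⟩
    simp only [ContinuousLinearMap.comp_apply, ContinuousLinearMap.prod_apply,
      ContinuousLinearMap.id_apply]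
    rw [hsplit, map_add, map_smul, map_add, map_smul, ← hv₀, hQv, smul_zero, add_zero]
  obtain ⟨U₁, hU₁, V, hV, hUV⟩ := mem_nhds_prod_iff.1 (hT.and hτiff)
  obtain ⟨U, hU, hUo, huU⟩ := eventually_nhds_iff.1 ((hfc.eventually_submersion hfs).and
    ((show ∀ᶠ x in 𝓝 u.1, x ∈ U₁ from hU₁).and
      (hτc.continuousAt.eventually (show ∀ᶠ t in 𝓝 (τ u.1), t ∈ V by rw [hτu]; exact hV))))
  refine ⟨U ×ˢ V, prod_mem_nhds (hUo.mem_nhds huU) hV, ?_⟩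
  intro x hx
  have hxU : x ∈ U := by
    obtain ⟨v, ⟨-, hv⟩, rfl⟩ := hx
    exact hv.1
  refine ⟨U, hUo, hxU, f, fun y hy => (hU y hy).1.1.contDiffWithinAt,
    fun y hy => (hU y hy).1.2, ?_⟩
  ext y
  constructor
  · rintro ⟨⟨⟨y', t⟩, ⟨hyT, hyU, htV⟩, rfl⟩, -⟩
    have h := hUV (Set.mk_mem_prod (hU y' hyU).2.1 htV)
    have h0 : F (y', t) = 0 := h.1.1 hyT
    have h1 : τ y' = t := h.2.1 (by rw [h0, map_zero])
    refine ⟨hyU, ?_⟩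
    simp only [hf, h1, h0, map_zero]
  · rintro ⟨hyU, hy⟩
    have h := hUV (Set.mk_mem_prod (hU y hyU).2.1 (hU y hyU).2.2)
    have h1 : l (F (y, τ y)) = 0 := h.2.2 rfl
    -- `Q` leaves only a multiple `a • v₀`, and `l` then forces `a = 0`.
    obtain ⟨a, ha⟩ := (hQ _).1 hy
    have h2 : F (y, τ y) = 0 := by
      rw [← ha, map_smul, hl, smul_eq_mul, mul_one] at h1
      rw [← ha, h1, zero_smul]
    exact ⟨⟨(y, τ y), ⟨h.1.2 h2, hyU, (hU y hyU).2.2⟩, rfl⟩, hyU⟩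

/-- `S` is a countable union of submanifolds of codimension at least `c`. -/
def CodimAtLeast (S : Set E) (c : ℕ) : Prop :=
  ∃ (M : ℕ → Set E) (k : ℕ → ℕ),
    (∀ i, IsSubmanifoldOfCodim (M i) (k i) ∧ c ≤ k i) ∧ S = ⋃ i, M i

theorem codimAtLeast_iUnion {ι : Type*} [Countable ι] {S : ι → Set E} {c : ℕ}
    (h : ∀ i, CodimAtLeast (S i) c) : CodimAtLeast (⋃ i, S i) c := by
  rcases isEmpty_or_nonempty ι with hι | hι
  · refine ⟨fun _ => ∅, fun _ => c, fun _ => ⟨fun x hx => hx.elim, le_rfl⟩, by simp⟩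
  · choose M k hk hS using h
    obtain ⟨g, hg⟩ := exists_surjective_nat (ι × ℕ)
    refine ⟨fun j => M (g j).1 (g j).2, fun j => k (g j).1 (g j).2, fun j => hk _ _, ?_⟩
    ext x
    simp only [Set.mem_iUnion, hS]
    constructor
    · rintro ⟨i, j, hx⟩
      obtain ⟨a, ha⟩ := hg (i, j)
      exact ⟨a, by rw [ha]; exact hx⟩
    · rintro ⟨a, hx⟩
      exact ⟨_, _, hx⟩

theorem IsSubmanifoldOfCodim.codimAtLeast {M : Set E} {c k : ℕ} (h : IsSubmanifoldOfCodim M k)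
    (hk : c ≤ k) : CodimAtLeast M c :=
  ⟨fun _ => M, fun _ => k, fun _ => ⟨h, hk⟩, by simp [Set.iUnion_const]⟩

/-- A projection of a set that is locally a submanifold is a countable union of submanifolds. -/
theorem codimAtLeast_image_fst [FiniteDimensional ℝ E] {T : Set (E × ℝ)} {c k : ℕ}
    (h : ∀ p ∈ T, ∃ W ∈ 𝓝 p, IsSubmanifoldOfCodim (Prod.fst '' (T ∩ W)) k) (hk : c ≤ k) :
    CodimAtLeast (Prod.fst '' T) c := by
  have : ProperSpace E := FiniteDimensional.proper_real E
  choose! W hW hM using h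
  -- Lindelöf: countably many of the local pieces cover `T`.
  obtain ⟨t, ht, htc, hcov⟩ := TopologicalSpace.countable_cover_nhdsWithin
    (fun p hp => mem_nhdsWithin_of_mem_nhds (hW p hp))
  have hunion : Prod.fst '' T = ⋃ p : t, Prod.fst '' (T ∩ W p) := by
    rw [← Set.image_iUnion, ← Set.inter_iUnion, Set.inter_eq_left.2]
    intro p hp
    obtain ⟨q, hq, hpq⟩ := Set.mem_iUnion₂.1 (hcov hp)
    exact Set.mem_iUnion.2 ⟨⟨q, hq⟩, hpq⟩
  rw [hunion]
  have : Countable t := htc.to_subtype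
  exact codimAtLeast_iUnion fun p => (hM p (ht p.2)).codimAtLeast hk

theorem CodimAtLeast.mono {S : Set E} {c c' : ℕ} (h : CodimAtLeast S c) (hc : c' ≤ c) :
    CodimAtLeast S c' := by
  obtain ⟨M, k, hk, hS⟩ := h
  exact ⟨M, k, fun i => ⟨(hk i).1, hc.trans (hk i).2⟩, hS⟩

theorem CodimAtLeast.union {S S' : Set E} {c : ℕ} (h : CodimAtLeast S c)
    (h' : CodimAtLeast S' c) : CodimAtLeast (S ∪ S') c := by
  rw [Set.union_eq_iUnion]
  exact codimAtLeast_iUnion fun b => by cases b <;> assumption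

/-- The witness `M` need not be a member of the given family: it is prepended as index 0, and
overlaps are harmless. -/
theorem CodimAtLeast.hasCodim {S M : Set E} {c : ℕ} (h : CodimAtLeast S c)
    (hM : IsSubmanifoldOfCodim M c) (hMS : M ⊆ S) (hne : M.Nonempty) : HasCodim S c := by
  obtain ⟨N, k, hk, hS⟩ := h
  refine ⟨fun i => Nat.casesOn i M N, fun i => Nat.casesOn i c k, ?_, ?_, 0, rfl, hne⟩
  · rintro (_ | i)
    · exact ⟨hM, le_rfl⟩
    · exact hk i
  · ext x
    simp only [Set.mem_iUnion]
    constructor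
    · intro hx
      rw [hS] at hx
      obtain ⟨i, hi⟩ := Set.mem_iUnion.1 hx
      exact ⟨i + 1, hi⟩
    · rintro ⟨_ | i, hi⟩
      · exact hMS hi
      · rw [hS]
        exact Set.mem_iUnion.2 ⟨i, hi⟩

end Submanifold

/-! ### Bordered matrices: equations for constant nullity. -/

noncomputable section Bordered

variable {𝕜 : Type*} [RCLike 𝕜] {n m : ℕ}

/-- The columns of `V` are an orthonormal basis of the kernel of `A`. -/
structure IsKernelFrame (A : Matrix (Fin n) (Fin n) 𝕜) (V : Matrix (Fin n) (Fin m) 𝕜) : Prop where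
  mul_eq_zero : A * V = 0
  orthonormal : Vᴴ * V = 1
  eq_zero : ∀ x, A *ᵥ x = 0 → Vᴴ *ᵥ x = 0 → x = 0

theorem exists_isKernelFrame (A : Matrix (Fin n) (Fin n) 𝕜)
    (hm : Module.finrank 𝕜 (LinearMap.ker (Matrix.toLin' A)) = m) :
    ∃ V : Matrix (Fin n) (Fin m) 𝕜, IsKernelFrame A V := by
  -- Orthonormality needs the Euclidean inner product, which plain functions do not carry.
  let e : EuclideanSpace 𝕜 (Fin n) ≃ₗ[𝕜] (Fin n → 𝕜) := WithLp.linearEquiv 2 𝕜 (Fin n → 𝕜)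
  let S : Submodule 𝕜 (EuclideanSpace 𝕜 (Fin n)) :=
    (LinearMap.ker (Matrix.toLin' A)).comap e.toLinearMap
  have hS : Module.finrank 𝕜 S = m := by
    rw [← hm]
    exact (e.submoduleMap S).finrank_eq.trans (by
      rw [Submodule.map_comap_eq_of_surjective e.surjective])
  let b : OrthonormalBasis (Fin m) 𝕜 S := (stdOrthonormalBasis 𝕜 S).reindex (finCongr hS)
  have hin : ∀ (j : Fin m) (x : EuclideanSpace 𝕜 (Fin n)),
      inner 𝕜 (b j : EuclideanSpace 𝕜 (Fin n)) x =
        ∑ i, star ((b j : EuclideanSpace 𝕜 (Fin n)) i) * x i := by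
    intro j x
    rw [PiLp.inner_apply]
    simp [mul_comm]
  refine ⟨Matrix.of fun i j => (b j : EuclideanSpace 𝕜 (Fin n)) i, ?_, ?_, ?_⟩
  · ext i j
    have h : A *ᵥ (e (b j : EuclideanSpace 𝕜 (Fin n))) = 0 := (b j).2
    exact congrFun h i
  · ext j k
    have h := (orthonormal_iff_ite.1 b.orthonormal) j k
    rw [Submodule.coe_inner, hin] at h
    simpa [Matrix.mul_apply, Matrix.one_apply] using h
  · intro x hx hVx
    have hxS : e.symm x ∈ S := by
      change A *ᵥ (e (e.symm x)) = 0
      rwa [e.apply_symm_apply]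
    have h0 : (⟨e.symm x, hxS⟩ : S) = 0 := by
      refine b.toBasis.ext_elem_iff.2 fun j => ?_
      simp only [OrthonormalBasis.coe_toBasis_repr_apply, OrthonormalBasis.repr_apply_apply,
        map_zero]
      rw [Submodule.coe_inner, hin]
      have := congrFun hVx j
      simp only [Matrix.mulVec, dotProduct] at this
      exact this
    have h1 : e.symm x = 0 := congrArg Subtype.val h0
    simpa using h1

/-- The matrix `A` bordered by `V` and `-Vᴴ`. -/
def bordered (V : Matrix (Fin n) (Fin m) 𝕜) (A : Matrix (Fin n) (Fin n) 𝕜) :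
    Matrix (Fin n ⊕ Fin m) (Fin n ⊕ Fin m) 𝕜 :=
  Matrix.fromBlocks A V (-Vᴴ) 0

/-- The lower right block of the inverse of the bordered matrix. -/
def borderedCorner (V : Matrix (Fin n) (Fin m) 𝕜) (A : Matrix (Fin n) (Fin n) 𝕜) :
    Matrix (Fin m) (Fin m) 𝕜 :=
  (bordered V A)⁻¹.toBlocks₂₂

/-- The sign in the border makes the whole bordered matrix skew-Hermitian, hence also its inverse.
This cuts the number of equations down to the dimension of the skew-Hermitian matrices. -/
theorem conjTranspose_borderedCorner {V : Matrix (Fin n) (Fin m) 𝕜} {A : Matrix (Fin n) (Fin n) 𝕜}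
    (hA : Aᴴ = -A) : (borderedCorner V A)ᴴ = -borderedCorner V A := by
  have h : (bordered V A)ᴴ = -bordered V A := by
    simp [bordered, Matrix.fromBlocks_conjTranspose, hA, Matrix.fromBlocks_neg]
  have h' : ((bordered V A)⁻¹)ᴴ = -(bordered V A)⁻¹ := by
    rw [Matrix.conjTranspose_nonsing_inv, h]
    by_cases hu : IsUnit (bordered V A).det
    · refine Matrix.inv_eq_left_inv ?_
      rw [neg_mul_neg, Matrix.nonsing_inv_mul _ hu]
    · have hu' : ¬ IsUnit (-bordered V A).det := by
        rw [Matrix.det_neg]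
        simpa using hu
      rw [Matrix.nonsing_inv_apply_not_isUnit _ hu,
        Matrix.nonsing_inv_apply_not_isUnit _ hu', neg_zero]
  ext i j
  exact congrFun (congrFun h' (Sum.inr i)) (Sum.inr j)

/-- The range of a skew-Hermitian `A` is orthogonal to its kernel, so applying `Vᴴ` to `A x + V w =
0` isolates `w`. -/
theorem IsKernelFrame.isUnit_bordered {V : Matrix (Fin n) (Fin m) 𝕜}
    {A : Matrix (Fin n) (Fin n) 𝕜} (hA : Aᴴ = -A) (hV : IsKernelFrame A V) :
    IsUnit (bordered V A) := by
  rw [← Matrix.mulVec_injective_iff_isUnit]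
  refine (injective_iff_map_eq_zero (Matrix.mulVecLin (bordered V A))).2 fun y hy => ?_
  obtain ⟨x, w, rfl⟩ : ∃ (x : Fin n → 𝕜) (w : Fin m → 𝕜), y = Sum.elim x w :=
    ⟨y ∘ Sum.inl, y ∘ Sum.inr, (Sum.elim_comp_inl_inr y).symm⟩
  have hVA : Vᴴ * A = 0 := by
    have := congrArg Matrix.conjTranspose hV.mul_eq_zero
    rw [Matrix.conjTranspose_mul, hA] at this
    simpa using this
  rw [Matrix.mulVecLin_apply, bordered, Matrix.fromBlocks_mulVec] at hy
  have h1 : A *ᵥ x + V *ᵥ w = 0 := by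
    ext i
    simpa using congrFun hy (Sum.inl i)
  have h2 : Vᴴ *ᵥ x = 0 := by
    ext i
    simpa [Matrix.neg_mulVec] using congrFun hy (Sum.inr i)
  have hw : w = 0 := by
    have := congrArg (Vᴴ *ᵥ ·) h1
    simpa [Matrix.mulVec_add, hVA, hV.orthonormal] using this
  subst hw
  have hx : x = 0 := hV.eq_zero x (by simpa using h1) h2
  subst hx
  ext (i | i) <;> rfl

/-- The kernels of `A` and of the corner have the same dimension. -/
theorem finrank_ker_borderedCorner {V : Matrix (Fin n) (Fin m) 𝕜}
    {A : Matrix (Fin n) (Fin n) 𝕜} (hu : IsUnit (bordered V A)) :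
    Module.finrank 𝕜 (LinearMap.ker (Matrix.toLin' (borderedCorner V A))) =
      Module.finrank 𝕜 (LinearMap.ker (Matrix.toLin' A)) := by
  have hdet := (Matrix.isUnit_iff_isUnit_det _).1 hu
  set N := (bordered V A)⁻¹ with hN
  have hNM : N * bordered V A = 1 := Matrix.nonsing_inv_mul _ hdet
  have hMN : bordered V A * N = 1 := Matrix.mul_nonsing_inv _ hdet
  have hNv : ∀ w : Fin m → 𝕜, N *ᵥ Sum.elim 0 w =
      Sum.elim (N.toBlocks₁₂ *ᵥ w) (borderedCorner V A *ᵥ w) := by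
    intro w
    conv_lhs => rw [← Matrix.fromBlocks_toBlocks N]
    rw [Matrix.fromBlocks_mulVec]
    simp [borderedCorner, hN]
  have hMv : ∀ x : Fin n → 𝕜, bordered V A *ᵥ Sum.elim x 0 =
      Sum.elim (A *ᵥ x) ((-Vᴴ) *ᵥ x) := by
    intro x
    rw [bordered, Matrix.fromBlocks_mulVec]
    simp
  have hA : ∀ x : Fin n → 𝕜, A *ᵥ x = 0 →
      borderedCorner V A *ᵥ ((-Vᴴ) *ᵥ x) = 0 ∧ N.toBlocks₁₂ *ᵥ ((-Vᴴ) *ᵥ x) = x := by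
    intro x hx
    have h := congrArg (N *ᵥ ·) (hMv x)
    simp only [Matrix.mulVec_mulVec, hNM, Matrix.one_mulVec, hx] at h
    rw [hNv] at h
    exact ⟨funext fun i => (congrFun h (Sum.inr i)).symm,
      funext fun i => (congrFun h (Sum.inl i)).symm⟩
  have hS : ∀ w : Fin m → 𝕜, borderedCorner V A *ᵥ w = 0 →
      A *ᵥ (N.toBlocks₁₂ *ᵥ w) = 0 ∧ (-Vᴴ) *ᵥ (N.toBlocks₁₂ *ᵥ w) = w := by
    intro w hw
    have h := congrArg (bordered V A *ᵥ ·) (hNv w)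
    simp only [Matrix.mulVec_mulVec, hMN, Matrix.one_mulVec, hw] at h
    rw [hMv] at h
    exact ⟨funext fun i => (congrFun h (Sum.inl i)).symm,
      funext fun i => (congrFun h (Sum.inr i)).symm⟩
  -- The maps `x ↦ -Vᴴ x` and `w ↦ N₁₂ w` are mutually inverse between the two kernels.
  exact LinearEquiv.finrank_eq
    { LinearMap.restrict (Matrix.toLin' N.toBlocks₁₂)
        (p := LinearMap.ker (Matrix.toLin' (borderedCorner V A)))
        (q := LinearMap.ker (Matrix.toLin' A)) (fun w hw => (hS w hw).1) with
      invFun := fun x => ⟨(-Vᴴ) *ᵥ x.1, (hA x.1 x.2).1⟩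
      left_inv := fun w => Subtype.ext (hS w.1 w.2).2
      right_inv := fun x => Subtype.ext (hA x.1 x.2).2 }

/-- Only invertibility is required, not that `V` frame the kernel of `A`; hence one fixed `V` serves
for all nearby matrices. -/
theorem borderedCorner_eq_zero_iff {V : Matrix (Fin n) (Fin m) 𝕜}
    {A : Matrix (Fin n) (Fin n) 𝕜} (hu : IsUnit (bordered V A)) :
    borderedCorner V A = 0 ↔ Module.finrank 𝕜 (LinearMap.ker (Matrix.toLin' A)) = m := by
  rw [← finrank_ker_borderedCorner hu]
  constructor
  · intro h
    rw [h, map_zero, LinearMap.ker_zero]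
    simp
  · intro h
    have : LinearMap.ker (Matrix.toLin' (borderedCorner V A)) = ⊤ :=
      Submodule.eq_top_of_finrank_eq (by simpa using h)
    exact Matrix.toLin'.map_eq_zero_iff.1 (LinearMap.ker_eq_top.1 this)

theorem IsKernelFrame.inv_toBlocks₁₂ {V : Matrix (Fin n) (Fin m) 𝕜}
    {A : Matrix (Fin n) (Fin n) 𝕜} (hA : Aᴴ = -A) (hV : IsKernelFrame A V) :
    (bordered V A)⁻¹.toBlocks₁₂ = -V := by
  have hdet := (Matrix.isUnit_iff_isUnit_det _).1 (hV.isUnit_bordered hA)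
  have h1 : bordered V A * Matrix.fromBlocks 0 (-V) 0 0 = Matrix.fromBlocks 0 0 0 1 := by
    simp [bordered, Matrix.fromBlocks_multiply, hV.mul_eq_zero, hV.orthonormal]
  have h2 := congrArg ((bordered V A)⁻¹ * ·) h1
  simp only [Matrix.nonsing_inv_mul_cancel_left _ _ hdet] at h2
  rw [← Matrix.fromBlocks_toBlocks (bordered V A)⁻¹, Matrix.fromBlocks_multiply] at h2
  simpa using (Matrix.fromBlocks_inj.1 h2).2.1.symm

theorem IsKernelFrame.inv_toBlocks₂₁ {V : Matrix (Fin n) (Fin m) 𝕜}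
    {A : Matrix (Fin n) (Fin n) 𝕜} (hA : Aᴴ = -A) (hV : IsKernelFrame A V) :
    (bordered V A)⁻¹.toBlocks₂₁ = Vᴴ := by
  have hdet := (Matrix.isUnit_iff_isUnit_det _).1 (hV.isUnit_bordered hA)
  have hVA : Vᴴ * A = 0 := by
    have := congrArg Matrix.conjTranspose hV.mul_eq_zero
    rw [Matrix.conjTranspose_mul, hA] at this
    simpa using this
  have h1 : Matrix.fromBlocks 0 0 Vᴴ 0 * bordered V A = Matrix.fromBlocks 0 0 0 1 := by
    simp [bordered, Matrix.fromBlocks_multiply, hVA, hV.orthonormal]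
  have h2 := congrArg (· * (bordered V A)⁻¹) h1
  simp only [Matrix.mul_nonsing_inv_cancel_right _ _ hdet] at h2
  rw [← Matrix.fromBlocks_toBlocks (bordered V A)⁻¹, Matrix.fromBlocks_multiply] at h2
  simpa using (Matrix.fromBlocks_inj.1 h2).2.2.1.symm

section Calculus

attribute [local instance] Matrix.linftyOpNormedRing Matrix.linftyOpNormedAlgebra

/-- Smoothness and derivative of the corner along a linear family of matrices. -/
theorem IsKernelFrame.contDiffAt_borderedCorner {E F : Type*} [NormedAddCommGroup E]
    [NormedSpace ℝ E] [FiniteDimensional ℝ E] [NormedAddCommGroup F] [NormedSpace ℝ F]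
    (a : E →ₗ[ℝ] Matrix (Fin n) (Fin n) 𝕜)
    (Λ : Matrix (Fin m) (Fin m) 𝕜 →ₗ[ℝ] F) {V : Matrix (Fin n) (Fin m) 𝕜} {x : E}
    (hA : (a x)ᴴ = -a x) (hV : IsKernelFrame (a x) V) :
    ContDiffAt ℝ ω (fun y => Λ (borderedCorner V (a y))) x ∧
      (∀ h, fderiv ℝ (fun y => Λ (borderedCorner V (a y))) x h = Λ (Vᴴ * a h * V)) ∧
      ∀ᶠ y in 𝓝 x, IsUnit (bordered V (a y)) := by
  let ι : Matrix (Fin n) (Fin n) 𝕜 →ₗ[ℝ] Matrix (Fin n ⊕ Fin m) (Fin n ⊕ Fin m) 𝕜 :=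
    { toFun := fun X => Matrix.fromBlocks X 0 0 0
      map_add' := fun X Y => by simp [Matrix.fromBlocks_add]
      map_smul' := fun r X => by simp [Matrix.fromBlocks_smul] }
  let π : Matrix (Fin n ⊕ Fin m) (Fin n ⊕ Fin m) 𝕜 →ₗ[ℝ] Matrix (Fin m) (Fin m) 𝕜 :=
    { toFun := fun X => X.toBlocks₂₂
      map_add' := fun X Y => rfl
      map_smul' := fun r X => rfl }
  let a' : E →L[ℝ] Matrix (Fin n ⊕ Fin m) (Fin n ⊕ Fin m) 𝕜 :=
    LinearMap.toContinuousLinearMap (ι ∘ₗ a)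
  let p : Matrix (Fin n ⊕ Fin m) (Fin n ⊕ Fin m) 𝕜 →L[ℝ] F :=
    LinearMap.toContinuousLinearMap (Λ ∘ₗ π)
  have hb : ∀ y, bordered V (a y) = bordered V 0 + a' y := by
    intro y
    simp [bordered, a', ι, Matrix.fromBlocks_add]
  have hf : (fun y => Λ (borderedCorner V (a y))) =
      fun y => p (Ring.inverse (bordered V 0 + a' y)) := by
    ext y
    simp only [borderedCorner, hb, Matrix.nonsing_inv_eq_ringInverse]
    rfl
  have hcomplete : @CompleteSpace (Matrix (Fin n ⊕ Fin m) (Fin n ⊕ Fin m) 𝕜)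
      PseudoMetricSpace.toUniformSpace := FiniteDimensional.complete ℝ _
  obtain ⟨u, hu⟩ := hV.isUnit_bordered hA
  have hu' : (↑u : Matrix (Fin n ⊕ Fin m) (Fin n ⊕ Fin m) 𝕜) = bordered V 0 + a' x := by
    rw [hu, hb]
  have hinv : ContDiffAt ℝ ω Ring.inverse (bordered V 0 + a' x) := by
    rw [← hu']
    exact contDiffAt_ringInverse ℝ u
  have hd : HasFDerivAt (fun y => bordered V 0 + a' y) a' x := a'.hasFDerivAt.const_add _
  have hinvd := hasFDerivAt_ringInverse (𝕜 := ℝ) u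
  rw [hu'] at hinvd
  refine ⟨?_, fun h => ?_, ?_⟩
  · rw [hf]
    exact p.contDiff.contDiffAt.comp x (hinv.comp x (contDiffAt_const.add a'.contDiff.contDiffAt))
  · rw [hf]
    have := p.hasFDerivAt.comp x (hinvd.comp x hd)
    have h2 := congrArg (fun L : E →L[ℝ] F => L h) this.fderiv
    refine h2.trans ?_
    have hui : (↑u⁻¹ : Matrix (Fin n ⊕ Fin m) (Fin n ⊕ Fin m) 𝕜) = (bordered V (a x))⁻¹ := by
      rw [← hu, Matrix.coe_units_inv]
    -- The derivative of inversion is `-N h N`. Its corner is `-(N₂₁ h N₁₂)`, with `N₂₁ = Vᴴ` and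
    -- `N₁₂ = -V`.
    change Λ (π (-((↑u⁻¹ : Matrix (Fin n ⊕ Fin m) (Fin n ⊕ Fin m) 𝕜) * ι (a h) *
      (↑u⁻¹ : Matrix (Fin n ⊕ Fin m) (Fin n ⊕ Fin m) 𝕜)))) = _
    rw [hui, ← Matrix.fromBlocks_toBlocks (bordered V (a x))⁻¹, hV.inv_toBlocks₁₂ hA,
      hV.inv_toBlocks₂₁ hA]
    congr 1
    change Matrix.toBlocks₂₂ (-(_ * Matrix.fromBlocks (a h) 0 0 0 * _)) = _
    rw [Matrix.fromBlocks_multiply, Matrix.fromBlocks_multiply, Matrix.fromBlocks_neg,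
      Matrix.toBlocks_fromBlocks₂₂]
    simp
  · have hc : ContinuousAt (fun y => bordered V 0 + a' y) x := hd.continuousAt
    have hmem : {T : Matrix (Fin n ⊕ Fin m) (Fin n ⊕ Fin m) 𝕜 | IsUnit T} ∈
        𝓝 (bordered V 0 + a' x) := Units.isOpen.mem_nhds ⟨u, hu'⟩
    filter_upwards [hc.preimage_mem_nhds hmem] with y hy
    rw [hb]
    exact hy

end Calculus

end Bordered

/-! ### Spectra of skew-Hermitian and skew-symmetric matrices. -/

section Spectrum

open Polynomial

/-- If `A - z` is skew-Hermitian, then `z` has the same geometric and algebraic multiplicity. -/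
theorem Matrix.finrank_ker_sub_smul_one_eq_rootMultiplicity {𝕜 : Type*} [RCLike 𝕜] {n : ℕ}
    (A : Matrix (Fin n) (Fin n) 𝕜) (z : 𝕜) (h : (A - z • 1)ᴴ = -(A - z • 1)) :
    Module.finrank 𝕜 (LinearMap.ker (Matrix.toLin' (A - z • 1))) =
      A.charpoly.rootMultiplicity z := by
  rw [← Matrix.charpoly_toLin', ← LinearMap.finrank_maxGenEigenspace_eq]
  have hB : Matrix.toLin' A - z • (1 : Module.End 𝕜 (Fin n → 𝕜)) = Matrix.toLin' (A - z • 1) := by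
    rw [map_sub, map_smul, Matrix.toLin'_one]
    rfl
  suffices hker : LinearMap.ker (Matrix.toLin' (A - z • 1)) =
      Module.End.maxGenEigenspace (Matrix.toLin' A) z by rw [hker]
  ext x
  rw [Module.End.mem_maxGenEigenspace, hB, LinearMap.mem_ker]
  constructor
  · intro hx
    exact ⟨1, by rwa [pow_one]⟩
  · rintro ⟨k, hk⟩
    induction k with
    | zero =>
      rw [pow_zero, Module.End.one_apply] at hk
      rw [hk, map_zero]
    | succ k ih =>
      rcases k with _ | k
      · simpa using hk
      · refine ih ?_
        rw [pow_succ', Module.End.mul_apply, Matrix.toLin'_apply]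
        rw [pow_succ', pow_succ', Module.End.mul_apply, Module.End.mul_apply, Matrix.toLin'_apply,
          Matrix.toLin'_apply, Matrix.mulVec_mulVec] at hk
        -- For `B = A - z` one has `Bᴴ B = -B²`, so `B² y = 0` forces `B y = 0`.
        rw [← Matrix.conjTranspose_mul_self_mulVec_eq_zero, h, neg_mul, Matrix.neg_mulVec, hk,
          neg_zero]

/-- The eigenvalues of a skew-Hermitian matrix are purely imaginary. -/
theorem Matrix.eq_im_mul_I_of_hasEigenvalue {n : ℕ} {A : Matrix (Fin n) (Fin n) ℂ} (hA : Aᴴ = -A)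
    {z : ℂ} (hz : Module.End.HasEigenvalue (Matrix.toLin' A) z) : z = z.im * Complex.I := by
  obtain ⟨x, hx⟩ := hz.exists_hasEigenvector
  have hAx : A *ᵥ x = z • x := hx.apply_eq_smul
  have h1 : star x ⬝ᵥ (A *ᵥ x) = z * (star x ⬝ᵥ x) := by
    rw [hAx, dotProduct_smul, smul_eq_mul]
  have h2 : star x ⬝ᵥ (A *ᵥ x) = -star z * (star x ⬝ᵥ x) := by
    have hs : star x ᵥ* A = -star (A *ᵥ x) := by
      rw [Matrix.star_mulVec, hA, Matrix.vecMul_neg, neg_neg]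
    rw [Matrix.dotProduct_mulVec, hs, hAx, neg_dotProduct, star_smul, smul_dotProduct, smul_eq_mul,
      neg_mul]
  have hne : star x ⬝ᵥ x ≠ 0 := fun h0 => hx.2 (dotProduct_star_self_eq_zero.1 h0)
  have hzz : z = -star z := mul_right_cancel₀ hne (h1.symm.trans h2)
  have hre := congrArg Complex.re hzz
  simp only [Complex.star_def, Complex.neg_re, Complex.conj_re] at hre
  apply Complex.ext <;> simp
  linarith

theorem Matrix.charpoly_comp_neg_X_of_transpose_eq_neg {F : Type*} [Field F] [Infinite F] {n : ℕ}
    {A : Matrix (Fin n) (Fin n) F} (hA : Aᵀ = -A) :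
    A.charpoly.comp (-X) = (-1) ^ n * A.charpoly := by
  refine Polynomial.funext fun t => ?_
  have h : Matrix.scalar (Fin n) (-t) - A = -(Matrix.scalar (Fin n) t - A)ᵀ := by
    rw [Matrix.transpose_sub, hA, map_neg, Matrix.scalar_apply, Matrix.diagonal_transpose]
    abel
  rw [eval_comp, eval_neg, eval_X, Matrix.eval_charpoly, h, Matrix.det_neg, Matrix.det_transpose,
    eval_mul, Matrix.eval_charpoly]
  simp

/-- The multiplicity of the eigenvalue `0` of a skew-symmetric matrix has the parity of its size. -/
theorem Matrix.even_rootMultiplicity_zero_iff {n : ℕ} {A : Matrix (Fin n) (Fin n) ℝ}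
    (hA : Aᵀ = -A) : Even (A.charpoly.rootMultiplicity 0) ↔ Even n := by
  have hp := A.charpoly_monic.ne_zero
  obtain ⟨q, hq, hq0⟩ := exists_eq_pow_rootMultiplicity_mul_and_not_dvd A.charpoly hp 0
  have hcomp := Matrix.charpoly_comp_neg_X_of_transpose_eq_neg hA
  set k := A.charpoly.rootMultiplicity 0
  rw [hq, map_zero, sub_zero, mul_comp, pow_comp, X_comp, neg_pow] at hcomp
  have h1 : (X : ℝ[X]) ^ k * ((-1) ^ k * q.comp (-X)) = X ^ k * ((-1) ^ n * q) := by
    linear_combination hcomp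
  -- After cancelling `X ^ k`, evaluation at 0 compares the signs, since `q` does not vanish there.
  have h2 := congrArg (eval 0) (mul_left_cancel₀ (pow_ne_zero k X_ne_zero) h1)
  rw [dvd_iff_isRoot, IsRoot.def] at hq0
  simp only [eval_mul, eval_pow, eval_neg, eval_one, eval_comp, eval_X, neg_zero] at h2
  have h3 : (-1 : ℝ) ^ k = (-1) ^ n := mul_right_cancel₀ hq0 h2
  rw [← neg_one_pow_eq_one_iff_even (R := ℝ) (by norm_num), h3,
    neg_one_pow_eq_one_iff_even (by norm_num)]

/-- The characteristic polynomial is even or odd, so `-z` is a double root too; the two coprime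
squares force degree at least 4. -/
theorem Matrix.four_le_of_two_le_rootMultiplicity {n : ℕ} {A : Matrix (Fin n) (Fin n) ℂ}
    (hA : Aᵀ = -A) {z : ℂ} (hz : z ≠ 0) (h : 2 ≤ A.charpoly.rootMultiplicity z) : 4 ≤ n := by
  have hp := A.charpoly_monic.ne_zero
  have h1 : (X - C z) ^ 2 ∣ A.charpoly := (le_rootMultiplicity_iff hp).1 h
  have h2 : (X - C (-z)) ^ 2 ∣ A.charpoly := by
    obtain ⟨q, hq⟩ := h1
    have hcomp := Matrix.charpoly_comp_neg_X_of_transpose_eq_neg hA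
    refine ⟨(-1) ^ n * q.comp (-X), ?_⟩
    have hsq : ((-1 : ℂ[X]) ^ n) * (-1) ^ n = 1 := by
      rw [← mul_pow]; simp
    have h3 : A.charpoly = (-1) ^ n * A.charpoly.comp (-X) := by
      rw [hcomp, ← mul_assoc, hsq, one_mul]
    rw [h3, hq]
    simp only [mul_comp, pow_comp, sub_comp, X_comp, C_comp, C_neg]
    ring
  have hne : z ≠ -z := fun h => hz (self_eq_neg.1 h)
  have hcop : IsCoprime ((X - C z) ^ 2) ((X - C (-z)) ^ 2) :=
    (isCoprime_X_sub_C_of_isUnit_sub (sub_ne_zero.2 hne).isUnit).pow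
  have hdeg := natDegree_le_of_dvd (hcop.mul_dvd h1 h2) hp
  rw [Matrix.charpoly_natDegree_eq_dim, Fintype.card_fin,
    natDegree_mul (pow_ne_zero _ (X_sub_C_ne_zero _)) (pow_ne_zero _ (X_sub_C_ne_zero _)),
    natDegree_pow, natDegree_pow, natDegree_X_sub_C, natDegree_X_sub_C] at hdeg
  exact hdeg

end Spectrum

/-! ### Repeated eigenvalues in terms of nullities. -/

section SkewSymm

variable {n : ℕ}

theorem transpose_skewSymm (K : skewSymm n) :
    (K : Matrix (Fin n) (Fin n) ℝ)ᵀ = -(K : Matrix (Fin n) (Fin n) ℝ) := K.2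

theorem complexify_conjTranspose (K : skewSymm n) :
    (complexify (K : Matrix (Fin n) (Fin n) ℝ))ᴴ = -complexify (K : Matrix (Fin n) (Fin n) ℝ) := by
  ext i j
  have := congrFun (congrFun (transpose_skewSymm K) i) j
  simp only [Matrix.transpose_apply, Matrix.neg_apply] at this
  simp [complexify, this]

theorem complexify_transpose (K : skewSymm n) :
    (complexify (K : Matrix (Fin n) (Fin n) ℝ))ᵀ = -complexify (K : Matrix (Fin n) (Fin n) ℝ) := by
  ext i j
  have := congrFun (congrFun (transpose_skewSymm K) i) j
  simp only [Matrix.transpose_apply, Matrix.neg_apply] at this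
  simp [complexify, this]

/-- The nullity of a real skew-symmetric matrix. -/
noncomputable def nullity (K : skewSymm n) : ℕ :=
  Module.finrank ℝ (LinearMap.ker (Matrix.toLin' (K : Matrix (Fin n) (Fin n) ℝ)))

theorem nullity_eq_rootMultiplicity (K : skewSymm n) :
    nullity K = (K : Matrix (Fin n) (Fin n) ℝ).charpoly.rootMultiplicity 0 := by
  have h := Matrix.finrank_ker_sub_smul_one_eq_rootMultiplicity
    (K : Matrix (Fin n) (Fin n) ℝ) 0 (by
      simpa [Matrix.conjTranspose_eq_transpose_of_trivial] using (transpose_skewSymm K))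
  rw [zero_smul, sub_zero] at h
  exact h

theorem even_nullity_iff (K : skewSymm n) : Even (nullity K) ↔ Even n := by
  rw [nullity_eq_rootMultiplicity]
  exact Matrix.even_rootMultiplicity_zero_iff (transpose_skewSymm K)

theorem mem_repeatedZeroSkew_iff (K : skewSymm n) : K ∈ repeatedZeroSkew n ↔ 2 ≤ nullity K := by
  rw [nullity_eq_rootMultiplicity,
    Polynomial.eq_rootMultiplicity_map (f := algebraMap ℝ ℂ) Complex.ofReal_injective,
    ← Matrix.charpoly_map, map_zero]
  rfl

theorem det_eq_zero_iff_nullity_ne_zero (K : skewSymm n) :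
    (K : Matrix (Fin n) (Fin n) ℝ).det = 0 ↔ nullity K ≠ 0 := by
  rw [nullity, Ne, Submodule.finrank_eq_zero, Matrix.ker_toLin'_eq_bot_iff,
    ← Matrix.exists_mulVec_eq_zero_iff]
  push Not
  constructor
  · rintro ⟨v, h0, hv⟩
    exact ⟨v, hv, h0⟩
  · rintro ⟨v, hv, h0⟩
    exact ⟨v, h0, hv⟩

/-- The dimension of the eigenspace of `μ i`. -/
noncomputable def imagEigendim (K : skewSymm n) (μ : ℝ) : ℕ :=
  Module.finrank ℂ (LinearMap.ker (Matrix.toLin'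
    (complexify (K : Matrix (Fin n) (Fin n) ℝ) - ((μ : ℂ) * Complex.I) • 1)))

theorem complexify_sub_conjTranspose (K : skewSymm n) (μ : ℝ) :
    (complexify (K : Matrix (Fin n) (Fin n) ℝ) - ((μ : ℂ) * Complex.I) • 1)ᴴ =
      -(complexify (K : Matrix (Fin n) (Fin n) ℝ) - ((μ : ℂ) * Complex.I) • 1) := by
  rw [Matrix.conjTranspose_sub, Matrix.conjTranspose_smul, complexify_conjTranspose]
  simp [neg_add_eq_sub]

theorem imagEigendim_eq_rootMultiplicity (K : skewSymm n) (μ : ℝ) :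
    imagEigendim K μ =
      (complexify (K : Matrix (Fin n) (Fin n) ℝ)).charpoly.rootMultiplicity (μ * Complex.I) :=
  Matrix.finrank_ker_sub_smul_one_eq_rootMultiplicity _ _ (complexify_sub_conjTranspose K μ)

theorem finrank_eigenspace_eq_imagEigendim (K : skewSymm n) (μ : ℝ) :
    Module.finrank ℂ (Module.End.eigenspace
      (Matrix.toLin' (complexify (K : Matrix (Fin n) (Fin n) ℝ))) (μ * Complex.I)) =
      imagEigendim K μ := by
  rw [imagEigendim, Module.End.eigenspace_def, map_sub, map_smul, Matrix.toLin'_one]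
  rfl

theorem IsRepeatedEigenvalue.eq_im_mul_I {K : skewSymm n} {z : ℂ}
    (h : IsRepeatedEigenvalue (K : Matrix (Fin n) (Fin n) ℝ) z) : z = z.im * Complex.I := by
  refine Matrix.eq_im_mul_I_of_hasEigenvalue (complexify_conjTranspose K) ?_
  rw [Module.End.hasEigenvalue_iff_isRoot_charpoly, Matrix.charpoly_toLin']
  have h' : 0 < (complexify (K : Matrix (Fin n) (Fin n) ℝ)).charpoly.rootMultiplicity z :=
    lt_of_lt_of_le two_pos h
  exact (Polynomial.rootMultiplicity_pos (Matrix.charpoly_monic _).ne_zero).1 h'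

theorem isDerogatory_iff (K : skewSymm n) :
    IsDerogatory (K : Matrix (Fin n) (Fin n) ℝ) ↔
      ∃ z, IsRepeatedEigenvalue (K : Matrix (Fin n) (Fin n) ℝ) z := by
  constructor
  · rintro ⟨z, hz⟩
    refine ⟨z, hz.trans ?_⟩
    rw [← Matrix.charpoly_toLin']
    exact LinearMap.finrank_eigenspace_le _ _
  · rintro ⟨z, hz⟩
    have h := hz.eq_im_mul_I
    refine ⟨z, ?_⟩
    rw [h, finrank_eigenspace_eq_imagEigendim, imagEigendim_eq_rootMultiplicity, ← h]
    exact hz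

theorem derogatorySkew_eq_union (n : ℕ) :
    derogatorySkew n = repeatedZeroSkew n ∪ repeatedNonzeroSkew n := by
  ext K
  refine (isDerogatory_iff K).trans ⟨?_, ?_⟩
  · rintro ⟨z, hz⟩
    by_cases h0 : z = 0
    · subst h0
      exact Or.inl hz
    · exact Or.inr ⟨z, h0, hz⟩
  · rintro (h | ⟨z, -, hz⟩)
    · exact ⟨0, h⟩
    · exact ⟨z, hz⟩

/-- For even `n` the nullity is even, so it is at least 2 as soon as it is nonzero. -/
theorem repeatedZeroSkew_eq_det_eq_zero (hn : Even n) :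
    repeatedZeroSkew n = {K : skewSymm n | (K : Matrix (Fin n) (Fin n) ℝ).det = 0} := by
  ext K
  have h := (even_nullity_iff K).2 hn
  rw [mem_repeatedZeroSkew_iff, Set.mem_ofPred_eq, det_eq_zero_iff_nullity_ne_zero]
  obtain ⟨k, hk⟩ := h
  omega

theorem repeatedNonzeroSkew_eq_empty (hn : n ≤ 3) : repeatedNonzeroSkew n = ∅ := by
  refine Set.eq_empty_of_forall_notMem ?_
  rintro K ⟨z, hz, h⟩
  have := Matrix.four_le_of_two_le_rootMultiplicity (complexify_transpose K) hz h
  omega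

theorem mem_repeatedNonzeroSkew_iff (K : skewSymm n) :
    K ∈ repeatedNonzeroSkew n ↔ ∃ μ : ℝ, μ ≠ 0 ∧ 2 ≤ imagEigendim K μ := by
  constructor
  · rintro ⟨z, hz, h⟩
    have hI := h.eq_im_mul_I
    refine ⟨z.im, fun h0 => hz ?_, ?_⟩
    · rw [hI, h0]
      simp
    · rw [imagEigendim_eq_rootMultiplicity, ← hI]
      exact h
  · rintro ⟨μ, hμ, h⟩
    refine ⟨μ * Complex.I, by simpa using hμ, ?_⟩
    rw [imagEigendim_eq_rootMultiplicity] at h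
    exact h

end SkewSymm

/-! ### Dimensions of spaces of skew-adjoint matrices. -/

section SkewAdjoint

/-- Real linear coordinates on the space of skew-Hermitian matrices, extended to all matrices. -/
theorem exists_skewAdjoint_coordinates {𝕜 : Type*} [RCLike 𝕜] {m c : ℕ}
    (hc : Module.finrank ℝ (skewAdjoint (Matrix (Fin m) (Fin m) 𝕜)) = c) :
    ∃ Λ : Matrix (Fin m) (Fin m) 𝕜 →ₗ[ℝ] (Fin c → ℝ),
      (∀ S, Sᴴ = -S → (Λ S = 0 ↔ S = 0)) ∧ ∀ y, ∃ S, Sᴴ = -S ∧ Λ S = y := by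
  have hpart : ∀ S : skewAdjoint (Matrix (Fin m) (Fin m) 𝕜),
      skewAdjointPart ℝ (S : Matrix (Fin m) (Fin m) 𝕜) = S :=
    LinearMap.congr_fun (skewAdjointPart_comp_subtype_skewAdjoint ℝ)
  have : Module.Finite ℝ (skewAdjoint (Matrix (Fin m) (Fin m) 𝕜)) :=
    Module.Finite.of_surjective (skewAdjointPart ℝ) fun S => ⟨S, hpart S⟩
  let e : skewAdjoint (Matrix (Fin m) (Fin m) 𝕜) ≃ₗ[ℝ] (Fin c → ℝ) :=
    LinearEquiv.ofFinrankEq _ _ (by simpa using hc)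
  refine ⟨e.toLinearMap ∘ₗ skewAdjointPart ℝ, fun S hS => ?_, fun y => ?_⟩
  · have := hpart ⟨S, skewAdjoint.mem_iff.2 hS⟩
    simp only at this
    simp [this]
  · refine ⟨(e.symm y : skewAdjoint _), skewAdjoint.mem_iff.1 (e.symm y).2, ?_⟩
    simp [hpart]

/-- Multiplication by `i` exchanges self-adjoint and skew-adjoint matrices, so each takes half of
the real dimension `2 m²`. -/
theorem finrank_skewAdjoint_complex (m : ℕ) :
    Module.finrank ℝ (skewAdjoint (Matrix (Fin m) (Fin m) ℂ)) = m * m := by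
  let e : skewAdjoint (Matrix (Fin m) (Fin m) ℂ) ≃ₗ[ℝ] selfAdjoint (Matrix (Fin m) (Fin m) ℂ) :=
    LinearEquiv.ofBijective skewAdjoint.negISMul (by
      constructor
      · intro S T h
        apply Subtype.ext
        rw [← skewAdjoint.I_smul_neg_I S, h, skewAdjoint.I_smul_neg_I]
      · intro S
        refine ⟨⟨Complex.I • (S : Matrix (Fin m) (Fin m) ℂ), ?_⟩, Subtype.ext ?_⟩
        · rw [skewAdjoint.mem_iff, star_smul, selfAdjoint.mem_iff.1 S.2]
          simp
        · simp [skewAdjoint.negISMul, smul_smul])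
  have hfs : Module.Finite ℝ (selfAdjoint (Matrix (Fin m) (Fin m) ℂ)) :=
    Module.Finite.of_surjective (selfAdjointPart ℝ) fun S =>
      ⟨S, LinearMap.congr_fun (selfAdjointPart_comp_subtype_selfAdjoint ℝ) S⟩
  have hfk : Module.Finite ℝ (skewAdjoint (Matrix (Fin m) (Fin m) ℂ)) :=
    Module.Finite.equiv e.symm
  have h := (StarModule.decomposeProdAdjoint ℝ (Matrix (Fin m) (Fin m) ℂ)).finrank_eq
  rw [Module.finrank_prod, ← e.finrank_eq, Module.finrank_matrix, Complex.finrank_real_complex,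
    Fintype.card_fin] at h
  omega

theorem finrank_skewAdjoint_real (m : ℕ) :
    Module.finrank ℝ (skewAdjoint (Matrix (Fin m) (Fin m) ℝ)) = m.choose 2 := by
  -- the coordinates are the entries above the diagonal
  let u : skewAdjoint (Matrix (Fin m) (Fin m) ℝ) →ₗ[ℝ] ((Σ j : Fin m, Fin j) → ℝ) :=
    { toFun := fun S p => (S : Matrix (Fin m) (Fin m) ℝ) (p.2.castLE p.1.2.le) p.1
      map_add' := fun S T => rfl
      map_smul' := fun r S => rfl }
  have hskew : ∀ (S : skewAdjoint (Matrix (Fin m) (Fin m) ℝ)) (i j : Fin m),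
      (S : Matrix (Fin m) (Fin m) ℝ) j i = -(S : Matrix (Fin m) (Fin m) ℝ) i j := by
    intro S i j
    have h : star (S : Matrix (Fin m) (Fin m) ℝ) = -S := skewAdjoint.mem_iff.1 S.2
    exact congrFun (congrFun h i) j
  have hu : Function.Bijective u := by
    constructor
    · intro S T h
      have hlt : ∀ i j : Fin m, i < j →
          (S : Matrix (Fin m) (Fin m) ℝ) i j = (T : Matrix (Fin m) (Fin m) ℝ) i j :=
        fun i j hij => congrFun h ⟨j, ⟨i, hij⟩⟩
      apply Subtype.ext
      ext i j
      rcases lt_trichotomy i j with hij | rfl | hij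
      · exact hlt i j hij
      · have h1 := hskew S i i
        have h2 := hskew T i i
        linarith
      · rw [hskew S, hskew T, hlt j i hij]
    · intro f
      let S : Matrix (Fin m) (Fin m) ℝ := Matrix.of fun i j =>
        if h : i < j then f ⟨j, ⟨i, h⟩⟩ else if h : j < i then -f ⟨i, ⟨j, h⟩⟩ else 0
      refine ⟨⟨S, ?_⟩, ?_⟩
      · rw [skewAdjoint.mem_iff]
        ext i j
        rcases lt_trichotomy i j with hij | rfl | hij
        · simp [S, Matrix.star_apply, hij, hij.not_gt]
        · simp [S, Matrix.star_apply]
        · simp [S, Matrix.star_apply, hij, hij.not_gt]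
      · ext ⟨j, i⟩
        have hij : i.castLE j.2.le < j := i.2
        exact dif_pos hij
  rw [(LinearEquiv.ofBijective u hu).finrank_eq, Module.finrank_fintype_fun_eq_card,
    Fintype.card_sigma]
  simp only [Fintype.card_fin]
  rw [Fin.sum_univ_eq_sum_range (fun i => i), Finset.sum_range_id, Nat.choose_two_right]

end SkewAdjoint

/-! ### The strata of fixed multiplicity. -/

section Strata

variable {n : ℕ}

/-- The corner is a submersion onto the real skew matrices: `V S Vᴴ` is a skew-symmetric direction
with derivative `S`. -/
theorem isSubmanifoldOfCodim_nullity_eq (n m : ℕ) :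
    IsSubmanifoldOfCodim {K : skewSymm n | nullity K = m} (m.choose 2) := by
  obtain ⟨Λ, hΛ, hΛs⟩ := exists_skewAdjoint_coordinates (finrank_skewAdjoint_real m)
  have hskew : ∀ K : skewSymm n, ((skewSymm n).subtype K)ᴴ = -(skewSymm n).subtype K := fun K => by
    rw [Matrix.conjTranspose_eq_transpose_of_trivial]
    exact transpose_skewSymm K
  refine isSubmanifoldOfCodim_of_eventually fun K hK => ?_
  obtain ⟨V, hV⟩ := exists_isKernelFrame (K : Matrix (Fin n) (Fin n) ℝ) hK
  obtain ⟨hc, hd, hu⟩ := hV.contDiffAt_borderedCorner (skewSymm n).subtype Λ (hskew K)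
  refine ⟨_, hc, fun y => ?_, ?_⟩
  · obtain ⟨S, hS, rfl⟩ := hΛs y
    have hX : V * S * Vᴴ ∈ skewSymm n := by
      change (V * S * Vᴴ)ᵀ = -(V * S * Vᴴ)
      rw [← Matrix.conjTranspose_eq_transpose_of_trivial, Matrix.conjTranspose_mul,
        Matrix.conjTranspose_mul, hS, Matrix.conjTranspose_conjTranspose]
      simp [Matrix.mul_assoc]
    refine ⟨⟨V * S * Vᴴ, hX⟩, ?_⟩
    rw [hd]
    congr 1
    change Vᴴ * (V * S * Vᴴ) * V = S
    calc Vᴴ * (V * S * Vᴴ) * V = (Vᴴ * V) * S * (Vᴴ * V) := by simp only [Matrix.mul_assoc]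
      _ = S := by rw [hV.orthonormal, Matrix.one_mul, Matrix.mul_one]
  · filter_upwards [hu] with L hL
    rw [hΛ _ (conjTranspose_borderedCorner (hskew L)), borderedCorner_eq_zero_iff hL]
    rfl

/-- The linear family `(K, μ) ↦ K - μ i`. -/
noncomputable def shiftedFamily (n : ℕ) : skewSymm n × ℝ →ₗ[ℝ] Matrix (Fin n) (Fin n) ℂ where
  toFun p := complexify (p.1 : Matrix (Fin n) (Fin n) ℝ) - ((p.2 : ℂ) * Complex.I) • 1
  map_add' p q := by
    ext i j
    simp [complexify]
    ring
  map_smul' r p := by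
    ext i j
    simp [complexify]
    ring

/-- The pairs `(K, μ)`, `μ ≠ 0`, for which `μ i` is an eigenvalue of `K` of multiplicity `m`. -/
def eigenpairs (n m : ℕ) : Set (skewSymm n × ℝ) :=
  {p | p.2 ≠ 0 ∧ imagEigendim p.1 p.2 = m}

/-- Moving `K` across the bilinear product changes its sign, so `VᵀV` equals its own negative up to
the factor `μ i ≠ 0`. -/
theorem transpose_mul_self_eq_zero {m : ℕ} {K : skewSymm n} {μ : ℝ} (hμ : μ ≠ 0)
    {V : Matrix (Fin n) (Fin m) ℂ}
    (hV : (complexify (K : Matrix (Fin n) (Fin n) ℝ) - ((μ : ℂ) * Complex.I) • 1) * V = 0) :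
    Vᵀ * V = 0 := by
  have h1 : complexify (K : Matrix (Fin n) (Fin n) ℝ) * V = ((μ : ℂ) * Complex.I) • V := by
    rw [Matrix.sub_mul, Matrix.smul_mul, Matrix.one_mul, sub_eq_zero] at hV
    exact hV
  have h2 : Vᵀ * complexify (K : Matrix (Fin n) (Fin n) ℝ) = -(((μ : ℂ) * Complex.I) • Vᵀ) := by
    have := congrArg Matrix.transpose h1
    rw [Matrix.transpose_mul, complexify_transpose, Matrix.transpose_smul, Matrix.mul_neg] at this
    rw [← this, neg_neg]
  have h3 : ((μ : ℂ) * Complex.I) • (Vᵀ * V) = -(((μ : ℂ) * Complex.I) • (Vᵀ * V)) := by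
    calc ((μ : ℂ) * Complex.I) • (Vᵀ * V)
        = Vᵀ * (complexify (K : Matrix (Fin n) (Fin n) ℝ) * V) := by rw [h1, Matrix.mul_smul]
      _ = Vᵀ * complexify (K : Matrix (Fin n) (Fin n) ℝ) * V := by rw [Matrix.mul_assoc]
      _ = _ := by rw [h2, Matrix.neg_mul, Matrix.smul_mul]
  have hz : ((μ : ℂ) * Complex.I) • (Vᵀ * V) = 0 := by
    ext i j
    exact self_eq_neg.1 (congrFun (congrFun h3 i) j)
  exact (smul_eq_zero.1 hz).resolve_left (by simpa using hμ)

/-- Compressions of real skew-symmetric matrices to the eigenspace of a nonzero eigenvalue exhaust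
the skew-Hermitian matrices. -/
theorem exists_skewSymm_compression {m : ℕ} {V : Matrix (Fin n) (Fin m) ℂ} (h0 : Vᵀ * V = 0)
    (h1 : Vᴴ * V = 1) {S : Matrix (Fin m) (Fin m) ℂ} (hS : Sᴴ = -S) :
    ∃ X : skewSymm n, Vᴴ * complexify (X : Matrix (Fin n) (Fin n) ℝ) * V = S := by
  set Z := V * S * Vᴴ with hZ
  have hZskew : Zᴴ = -Z := by
    simp [hZ, Matrix.conjTranspose_mul, hS, Matrix.mul_assoc]
  -- The real matrix `Z + conj Z` compresses to `S`: the conjugate term contains the factor `VᵀV =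
  -- 0`.
  have hX : Matrix.of (fun i j => 2 * (Z i j).re) ∈ skewSymm n := by
    change _ᵀ = -_
    ext i j
    have := congrArg Complex.re (congrFun (congrFun hZskew i) j)
    simp only [Matrix.conjTranspose_apply, Complex.star_def, Complex.conj_re, Matrix.neg_apply,
      Complex.neg_re] at this
    simp [this]
  have hXZ : complexify (Matrix.of (fun i j => 2 * (Z i j).re)) = Z + Z.map star := by
    ext i j
    simp only [complexify, Matrix.map_apply, Matrix.of_apply, Matrix.add_apply, Complex.star_def]
    rw [Complex.add_conj]
  refine ⟨⟨_, hX⟩, ?_⟩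
  have hZc : Z.map star = V.map star * S.map star * Vᵀ := by
    have h : Vᵀ = Vᴴ.map star := by ext i j; simp
    rw [h, hZ]
    ext i j
    simp [Matrix.mul_apply]
  change Vᴴ * complexify (Matrix.of (fun i j => 2 * (Z i j).re)) * V = S
  rw [hXZ, hZc, hZ]
  calc Vᴴ * (V * S * Vᴴ + V.map star * S.map star * Vᵀ) * V
      = (Vᴴ * V) * S * (Vᴴ * V) + Vᴴ * (V.map star * S.map star) * (Vᵀ * V) := by
        simp only [Matrix.mul_add, Matrix.add_mul, Matrix.mul_assoc]
    _ = S := by rw [h0, h1, Matrix.one_mul, Matrix.mul_one, Matrix.mul_zero, add_zero]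

theorem exists_isSubmanifoldOfCodim_eigenpairs {m : ℕ} (hm : 2 ≤ m) {p : skewSymm n × ℝ}
    (hp : p ∈ eigenpairs n m) :
    ∃ W ∈ 𝓝 p, IsSubmanifoldOfCodim (Prod.fst '' (eigenpairs n m ∩ W)) (m * m - 1) := by
  -- Of the `m * m` equations, one is spent on eliminating `μ`.
  have hmm : m * m - 1 + 1 = m * m := Nat.sub_add_cancel (by nlinarith)
  obtain ⟨Λ, hΛ, hΛs⟩ := exists_skewAdjoint_coordinates (𝕜 := ℂ) (m := m) (c := m * m - 1 + 1)
    (by rw [finrank_skewAdjoint_complex, hmm])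
  have hskew : ∀ q, (shiftedFamily n q)ᴴ = -shiftedFamily n q := fun q =>
    complexify_sub_conjTranspose q.1 q.2
  obtain ⟨V, hV⟩ := exists_isKernelFrame (shiftedFamily n p) hp.2
  obtain ⟨hc, hd, hu⟩ := hV.contDiffAt_borderedCorner (shiftedFamily n) Λ (hskew p)
  have : @CompleteSpace (skewSymm n) PseudoMetricSpace.toUniformSpace :=
    FiniteDimensional.complete ℝ _
  refine exists_isSubmanifoldOfCodim_image_fst hp hc ?_ ?_ ?_
  · have hne : ∀ᶠ q : skewSymm n × ℝ in 𝓝 p, q.2 ≠ 0 :=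
      continuous_snd.continuousAt.eventually_ne hp.1
    filter_upwards [hu, hne] with q hq hq0
    rw [hΛ _ (conjTranspose_borderedCorner (hskew q)), borderedCorner_eq_zero_iff hq]
    exact ⟨fun h => h.2, fun h => ⟨hq0, h⟩⟩
  · intro y
    obtain ⟨S, hS, rfl⟩ := hΛs y
    obtain ⟨X, hX⟩ := exists_skewSymm_compression
      (transpose_mul_self_eq_zero hp.1 hV.mul_eq_zero) hV.orthonormal hS
    refine ⟨X, ?_⟩
    simp only [hd]
    rw [← hX]
    simp [shiftedFamily]
  · rw [hd]
    -- The derivative in `μ` is `-i` times the identity of size `m > 0`, hence nonzero.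
    have h : Vᴴ * shiftedFamily n (0, 1) * V = -(Complex.I • (1 : Matrix (Fin m) (Fin m) ℂ)) := by
      have h0 : shiftedFamily n (0, 1) = -(Complex.I • (1 : Matrix (Fin n) (Fin n) ℂ)) := by
        ext i j
        simp [shiftedFamily, complexify]
      rw [h0]
      simp [hV.orthonormal]
    rw [h, Ne, hΛ _ (by simp), neg_eq_zero]
    intro h'
    have := congrFun (congrFun h' ⟨0, by omega⟩) ⟨0, by omega⟩
    simp at this

theorem codimAtLeast_image_eigenpairs {m : ℕ} (hm : 2 ≤ m) :
    CodimAtLeast (Prod.fst '' eigenpairs n m) 3 := by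
  have h4 : 3 ≤ m * m - 1 := by
    have : 2 * 2 ≤ m * m := Nat.mul_le_mul hm hm
    omega
  exact codimAtLeast_image_fst (fun p hp => exists_isSubmanifoldOfCodim_eigenpairs hm hp) h4

theorem codimAtLeast_repeatedNonzeroSkew (n : ℕ) : CodimAtLeast (repeatedNonzeroSkew n) 3 := by
  have h : repeatedNonzeroSkew n = ⋃ k : ℕ, Prod.fst '' eigenpairs n (k + 2) := by
    ext K
    rw [mem_repeatedNonzeroSkew_iff, Set.mem_iUnion]
    constructor
    · rintro ⟨μ, hμ, h⟩
      exact ⟨imagEigendim K μ - 2, (K, μ), ⟨hμ, (Nat.sub_add_cancel h).symm⟩, rfl⟩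
    · rintro ⟨k, ⟨K', μ⟩, ⟨hμ, h⟩, rfl⟩
      exact ⟨μ, hμ, (Nat.le_add_left 2 k).trans_eq h.symm⟩
  rw [h]
  exact codimAtLeast_iUnion fun k => codimAtLeast_image_eigenpairs (by omega)

theorem codimAtLeast_le_nullity (n m : ℕ) :
    CodimAtLeast {K : skewSymm n | m ≤ nullity K} (m.choose 2) := by
  have h : {K : skewSymm n | m ≤ nullity K} = ⋃ k : ℕ, {K : skewSymm n | nullity K = k + m} := by
    ext K
    simp only [Set.mem_ofPred_eq, Set.mem_iUnion]
    exact ⟨fun h => ⟨nullity K - m, (Nat.sub_add_cancel h).symm⟩, fun ⟨k, hk⟩ => by omega⟩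
  rw [h]
  exact codimAtLeast_iUnion fun k => (isSubmanifoldOfCodim_nullity_eq n _).codimAtLeast
    (Nat.choose_le_choose 2 (Nat.le_add_left m k))

end Strata

/-! ### Explicit points on the strata. -/

section PairingMatrix

/-- The involution of `(Fin k × Bool) ⊕ Fin c` exchanging the members of each pair. -/
def swapPair {k c : ℕ} : (Fin k × Bool) ⊕ Fin c → (Fin k × Bool) ⊕ Fin c :=
  Sum.map (Prod.map id not) id

/-- The sign of an index: `±1` on pairs and `0` elsewhere. -/
def pairSign {k c : ℕ} : (Fin k × Bool) ⊕ Fin c → ℝ :=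
  Sum.elim (fun p => if p.2 then 1 else -1) 0

theorem swapPair_swapPair {k c : ℕ} (i : (Fin k × Bool) ⊕ Fin c) : swapPair (swapPair i) = i := by
  rcases i with ⟨i, b⟩ | i <;> simp [swapPair]

theorem pairSign_swapPair {k c : ℕ} (i : (Fin k × Bool) ⊕ Fin c) :
    pairSign (swapPair i) = -pairSign i := by
  rcases i with ⟨i, _ | _⟩ | i <;> simp [swapPair, pairSign]

variable {n k c : ℕ} (e : Fin n ≃ (Fin k × Bool) ⊕ Fin c)

/-- The direct sum of `k` rotation generators and a zero block of size `c`. -/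
noncomputable def pairingMatrix : skewSymm n :=
  ⟨Matrix.of fun i j => if e j = swapPair (e i) then pairSign (e i) else 0, by
    change _ᵀ = -_
    ext i j
    simp only [Matrix.transpose_apply, Matrix.of_apply, Matrix.neg_apply]
    by_cases h : e j = swapPair (e i)
    · have h' : e i = swapPair (e j) := by rw [h, swapPair_swapPair]
      rw [if_pos h, if_pos h', h, pairSign_swapPair]
    · have h' : ¬ e i = swapPair (e j) := fun h' => h (by rw [h', swapPair_swapPair])
      rw [if_neg h, if_neg h', neg_zero]⟩

theorem pairingMatrix_mulVec (x : Fin n → ℝ) (i : Fin n) :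
    ((pairingMatrix e : Matrix (Fin n) (Fin n) ℝ) *ᵥ x) i =
      pairSign (e i) * x (e.symm (swapPair (e i))) := by
  simp only [Matrix.mulVec, dotProduct, pairingMatrix, Matrix.of_apply, ite_mul, zero_mul,
    ← Equiv.eq_symm_apply]
  simp

theorem complexify_pairingMatrix_mulVec (x : Fin n → ℂ) (i : Fin n) :
    (complexify (pairingMatrix e : Matrix (Fin n) (Fin n) ℝ) *ᵥ x) i =
      pairSign (e i) * x (e.symm (swapPair (e i))) := by
  have h : ∀ j, complexify (pairingMatrix e : Matrix (Fin n) (Fin n) ℝ) i j =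
      if j = e.symm (swapPair (e i)) then (pairSign (e i) : ℂ) else 0 := by
    intro j
    simp only [complexify, pairingMatrix, Matrix.map_apply, Matrix.of_apply, ← Equiv.eq_symm_apply]
    split_ifs <;> simp
  simp only [Matrix.mulVec, dotProduct, h, ite_mul, zero_mul]
  simp

theorem nullity_pairingMatrix : nullity (pairingMatrix e) = c := by
  let u : (Fin c → ℝ) →ₗ[ℝ] (Fin n → ℝ) :=
    { toFun := fun y i => Sum.elim (fun _ => 0) y (e i)
      map_add' := fun y z => by
        ext i
        rcases h : e i with p | j <;> simp [h]
      map_smul' := fun r y => by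
        ext i
        rcases h : e i with p | j <;> simp [h] }
  have hu : Function.Injective u := fun y z h => by
    ext j
    simpa [u] using congrFun h (e.symm (Sum.inr j))
  have hrange : LinearMap.range u =
      LinearMap.ker (Matrix.toLin' (pairingMatrix e : Matrix (Fin n) (Fin n) ℝ)) := by
    ext x
    rw [LinearMap.mem_range, LinearMap.mem_ker, Matrix.toLin'_apply]
    constructor
    · rintro ⟨y, rfl⟩
      ext i
      rw [pairingMatrix_mulVec]
      rcases h : e i with p | j <;> simp [u, swapPair, pairSign]
    · intro hx
      refine ⟨fun j => x (e.symm (Sum.inr j)), ?_⟩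
      ext i
      rcases h : e i with ⟨p, b⟩ | j
      · have := congrFun hx (e.symm (swapPair (e i)))
        rw [pairingMatrix_mulVec, e.apply_symm_apply, swapPair_swapPair, e.symm_apply_apply,
          pairSign_swapPair, h] at this
        have hi : x i = 0 := by
          cases b <;> simpa [pairSign] using this
        simp [u, h, hi]
      · have h2 : e.symm (Sum.inr j) = i := by rw [← h, e.symm_apply_apply]
        simp [u, h, h2]
  rw [nullity, ← hrange, LinearMap.finrank_range_of_inj hu]
  simp

theorem imagEigendim_pairingMatrix : imagEigendim (pairingMatrix e) 1 = k := by
  -- An eigenvector for `i` is free at the `true` member of each pair, `i` times that value at the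
  -- `false` member, and zero off the pairs.
  let u : (Fin k → ℂ) →ₗ[ℂ] (Fin n → ℂ) :=
    { toFun := fun y i => Sum.elim (fun p => if p.2 then y p.1 else Complex.I * y p.1) 0 (e i)
      map_add' := fun y z => by
        ext i
        rcases h : e i with ⟨p, _ | _⟩ | j <;> simp [h, mul_add]
      map_smul' := fun r y => by
        ext i
        rcases h : e i with ⟨p, _ | _⟩ | j <;> simp [h, mul_left_comm] }
  have hu : Function.Injective u := fun y z h => by
    ext j
    simpa [u] using congrFun h (e.symm (Sum.inl (j, true)))
  have hker : ∀ x, x ∈ LinearMap.ker (Matrix.toLin'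
      (complexify (pairingMatrix e : Matrix (Fin n) (Fin n) ℝ) -
        (((1 : ℝ) : ℂ) * Complex.I) • 1)) ↔
      ∀ i, (pairSign (e i) : ℂ) * x (e.symm (swapPair (e i))) = Complex.I * x i := by
    intro x
    rw [LinearMap.mem_ker, Matrix.toLin'_apply, Matrix.sub_mulVec, sub_eq_zero, funext_iff]
    refine forall_congr' fun i => ?_
    rw [complexify_pairingMatrix_mulVec]
    simp [Matrix.smul_mulVec]
  have hrange : LinearMap.range u = LinearMap.ker (Matrix.toLin'
      (complexify (pairingMatrix e : Matrix (Fin n) (Fin n) ℝ) -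
        (((1 : ℝ) : ℂ) * Complex.I) • 1)) := by
    ext x
    rw [LinearMap.mem_range, hker]
    constructor
    · rintro ⟨y, rfl⟩ i
      rcases h : e i with ⟨p, _ | _⟩ | j <;>
        simp [u, swapPair, pairSign, h, ← mul_assoc]
    · intro hx
      refine ⟨fun j => x (e.symm (Sum.inl (j, true))), ?_⟩
      ext i
      have hi := hx i
      rcases h : e i with ⟨p, _ | _⟩ | j
      · have h1 := hx (e.symm (Sum.inl (p, true)))
        have h2 : e.symm (Sum.inl (p, false)) = i := by rw [← h, e.symm_apply_apply]
        simp only [Equiv.apply_symm_apply, pairSign, swapPair, Sum.map_inl, Prod.map_apply,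
          Bool.not_true, id_eq, Sum.elim_inl, if_true, h2, Complex.ofReal_one, one_mul] at h1
        simp only [u, LinearMap.coe_mk, AddHom.coe_mk, h, Sum.elim_inl, Bool.false_eq_true,
          if_false]
        exact h1.symm
      · have h2 : e.symm (Sum.inl (p, true)) = i := by rw [← h, e.symm_apply_apply]
        simp only [u, LinearMap.coe_mk, AddHom.coe_mk, h, Sum.elim_inl, if_true, h2]
      · rw [h] at hi
        have hi0 : x i = 0 := by simpa [pairSign] using hi.symm
        simp [u, h, hi0]
  rw [imagEigendim, ← hrange, LinearMap.finrank_range_of_inj hu]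
  simp

end PairingMatrix

/-! ### Assembling the codimensions. -/

section MainTheorem

variable {n : ℕ}

theorem exists_nullity_eq {c : ℕ} (hc : c ≤ n) (hpar : Even (n - c)) :
    ∃ K : skewSymm n, nullity K = c := by
  obtain ⟨k, hk⟩ := hpar
  exact ⟨_, nullity_pairingMatrix (k := k) (c := c)
    (Fintype.equivOfCardEq (by simp; omega))⟩

theorem hasCodim_le_nullity {c : ℕ} (hc : c ≤ n) (hpar : Even (n - c)) :
    HasCodim {K : skewSymm n | c ≤ nullity K} (c.choose 2) :=
  (codimAtLeast_le_nullity n c).hasCodim (isSubmanifoldOfCodim_nullity_eq n c)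
    (fun _ hK => hK.ge) (exists_nullity_eq hc hpar)

theorem repeatedZeroSkew_eq (n : ℕ) : repeatedZeroSkew n = {K : skewSymm n | 2 ≤ nullity K} :=
  Set.ext mem_repeatedZeroSkew_iff

/-- For odd `n` the nullity is odd, so 2 improves to 3 and the codimension becomes `Nat.choose 3 2 =
3`. -/
theorem repeatedZeroSkew_eq_of_odd (hn : Odd n) :
    repeatedZeroSkew n = {K : skewSymm n | 3 ≤ nullity K} := by
  rw [repeatedZeroSkew_eq]
  ext K
  have h : ¬ Even (nullity K) := by rwa [even_nullity_iff, Nat.not_even_iff_odd]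
  obtain ⟨k, hk⟩ := Nat.not_even_iff_odd.1 h
  simp only [Set.mem_ofPred_eq]
  omega

theorem HasCodim.union {E : Type*} [NormedAddCommGroup E] [NormedSpace ℝ E] {S S' : Set E}
    {c : ℕ} (h : HasCodim S c) (h' : CodimAtLeast S' c) : HasCodim (S ∪ S') c := by
  obtain ⟨M, k, hk, hS, i, hi, hne⟩ := h
  have hS' : CodimAtLeast S c := ⟨M, k, hk, hS⟩
  refine (hS'.union h').hasCodim (M := M i) (hi ▸ (hk i).1) (fun x hx => Or.inl ?_) hne
  rw [hS]
  exact Set.mem_iUnion.2 ⟨i, hx⟩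

theorem hasCodim_repeatedNonzeroSkew (hn : 4 ≤ n) : HasCodim (repeatedNonzeroSkew n) 3 := by
  -- Two rotation generators make `i` an eigenvalue of multiplicity exactly 2, on a stratum of
  -- codimension `2 * 2 - 1 = 3`.
  let e : Fin n ≃ (Fin 2 × Bool) ⊕ Fin (n - 4) := Fintype.equivOfCardEq (by simp; omega)
  have hmem : (pairingMatrix e, (1 : ℝ)) ∈ eigenpairs n 2 :=
    ⟨one_ne_zero, imagEigendim_pairingMatrix e⟩
  obtain ⟨W, hW, hM⟩ := exists_isSubmanifoldOfCodim_eigenpairs le_rfl hmem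
  refine (codimAtLeast_repeatedNonzeroSkew n).hasCodim hM ?_
    ⟨_, _, ⟨hmem, mem_of_mem_nhds hW⟩, rfl⟩
  rintro _ ⟨⟨K, μ⟩, ⟨⟨hμ, h⟩, -⟩, rfl⟩
  exact (mem_repeatedNonzeroSkew_iff K).2 ⟨μ, hμ, h.ge⟩

end MainTheorem

theorem mainTheorem1 (n : ℕ) :
    -- derogatory skew-symmetric matrices
    (Even n → 2 ≤ n → HasCodim (derogatorySkew n) 1) ∧
    (Odd n → 3 ≤ n → HasCodim (derogatorySkew n) 3) ∧
    -- repeated nonzero eigenvalues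
    (4 ≤ n → HasCodim (repeatedNonzeroSkew n) 3) ∧
    (n ≤ 3 → repeatedNonzeroSkew n = ∅) ∧
    -- in the even case, codimension 1 comes from a double eigenvalue at 0, i.e. from `det K = 0`
    (Even n → 2 ≤ n →
      repeatedZeroSkew n = {K : skewSymm n | (K : Matrix (Fin n) (Fin n) ℝ).det = 0} ∧
      HasCodim {K : skewSymm n | (K : Matrix (Fin n) (Fin n) ℝ).det = 0} 1 ∧
      derogatorySkew n =
        {K : skewSymm n | (K : Matrix (Fin n) (Fin n) ℝ).det = 0} ∪ repeatedNonzeroSkew n) := by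

  have heven : Even n → 2 ≤ n → HasCodim (repeatedZeroSkew n) 1 := fun hn h2 => by
    rw [repeatedZeroSkew_eq]
    exact hasCodim_le_nullity (c := 2) h2 ((Nat.even_sub h2).2 (by simpa using hn))
  refine ⟨fun hn h2 => ?_, fun hn h3 => ?_, hasCodim_repeatedNonzeroSkew,
    repeatedNonzeroSkew_eq_empty, fun hn h2 => ⟨repeatedZeroSkew_eq_det_eq_zero hn, ?_, ?_⟩⟩
  · rw [derogatorySkew_eq_union]
    exact (heven hn h2).union ((codimAtLeast_repeatedNonzeroSkew n).mono (by norm_num))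
  · rw [derogatorySkew_eq_union, repeatedZeroSkew_eq_of_odd hn]
    exact (hasCodim_le_nullity (c := 3) h3 (Nat.Odd.sub_odd hn (by decide))).union
      (codimAtLeast_repeatedNonzeroSkew n)
  · rw [← repeatedZeroSkew_eq_det_eq_zero hn]
    exact heven hn h2
  · rw [← repeatedZeroSkew_eq_det_eq_zero hn, derogatorySkew_eq_union]
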